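/- Let $D$ be a finite set of variables. A probabilistic team over $D$ with values in a finite set $A$ is a finite set $X$ of assignments $s\colon D\to A$ together with a function $\mathbb{X}\colon X\to(0,1]$ with $\sum_{s\in X}\mathbb{X}(s)=1$. For tuples $\bar x,\bar y$ (possibly empty) of variables and single variables $x,y$, define satisfaction as follows. - Functional dependency (FD): $\mathbb{X}\models{=}(\bar x,\bar y)$ iff for all $s,s'\in X$, $s(\bar x)=s'(\bar x)$ implies $s(\bar y)=s'(\bar y)$. - Unary inclusion dependency (UIND): $\mathbb{X}\models x\subseteq y$ iff for every $s\in X$ there is $s'\in X$ with $s(x)=s'(y)$. - Unary marginal identity (UMI): $\mathbb{X}\models x\approx y$ iff $\sum_{s\in X,\,s(x)=a}\mathbb{X}(s)=\sum_{s\in X,\,s(y)=a}\mathbb{X}(s)$ for all $a\in A$. For a set $\Sigma$ of such atoms and an atom $\sigma$, write $\Sigma\models\sigma$ if every probabilistic team over $D$ (with values in any finite set $A$) that satisfies all atoms of $\Sigma$ also satisfies $\sigma$. Theorem. Let $\Sigma_{\mathrm{FD}}$ be a set of FDs and $\Sigma_{\mathrm{UMI}}$ a set of UMIs over $D$. Put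 $\Sigma=\Sigma_{\mathrm{FD}}\cup\Sigma_{\mathrm{UMI}}$ and $$\Sigma^*=\Sigma_{\mathrm{FD}}\cup\{x\subseteq y\mid x\approx y\in\Sigma_{\mathrm{UMI}}\text{ or }y\approx x\in\Sigma_{\mathrm{UMI}}\}.$$ Then for every FD $\sigma$ over $D$ and all variables $x,y\in D$: (i) $\Sigma\models\sigma$ if and only if $\Sigma^*\models\sigma$; (ii) $\Sigma\models x\approx y$ if and only if $\Sigma^*\models x\subseteq y$ and $\Sigma^*\models y\subseteq x$. -/

import Mathlib

universe u v

namespace ProbTeamSem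

/-- A probabilistic team over the variables `D` with values in `A`: a finite set `rows` of
assignments `s : D → A` together with a function `rows → (0,1]` whose values sum to `1`. -/
structure ProbTeam (D : Type u) (A : Type v) where
  rows : Finset (D → A)
  weight : {s : D → A // s ∈ rows} → ℝ
  weight_mem : ∀ s, weight s ∈ Set.Ioc (0 : ℝ) 1
  weight_sum : ∑ s, weight s = 1

open Classical in
/-- The marginal probability that the variable `x` has the value `a`. -/
noncomputable def ProbTeam.marginal {D : Type u} {A : Type v} (X : ProbTeam D A)
    (x : D) (a : A) : ℝ :=
  ∑ s : {s : D → A // s ∈ X.rows} with s.1 x = a, X.weight s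

/-- Functional dependency atoms between (possibly empty) tuples of variables, unary inclusion
atoms `x ⊆ y`, and unary marginal identity atoms `x ≈ y`. -/
inductive Atom (D : Type u) : Type u
  | fd (xs ys : List D)
  | uind (x y : D)
  | umi (x y : D)

/-- The atom is a functional dependency. -/
def Atom.IsFD {D : Type u} (σ : Atom D) : Prop := ∃ xs ys : List D, σ = Atom.fd xs ys

/-- The atom is a unary marginal identity. -/
def Atom.IsUMI {D : Type u} (σ : Atom D) : Prop := ∃ x y : D, σ = Atom.umi x y

/-- Satisfaction of an atom in a probabilistic team. For a tuple `xs` of variables,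
`xs.map s` is the tuple `s(xs)` of values. -/
def ProbTeam.Sat {D : Type u} {A : Type v} (X : ProbTeam D A) : Atom D → Prop
  | Atom.fd xs ys => ∀ s ∈ X.rows, ∀ s' ∈ X.rows, xs.map s = xs.map s' → ys.map s = ys.map s'
  | Atom.uind x y => ∀ s ∈ X.rows, ∃ s' ∈ X.rows, s x = s' y
  | Atom.umi x y => ∀ a : A, X.marginal x a = X.marginal y a

/-- Logical implication: every probabilistic team over `D`, with values in any finite set `A`,
that satisfies all atoms of `S` also satisfies `σ`. As the value sets are finite, letting `A`
range over `Type` covers all of them up to a bijection. -/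
def Implies {D : Type u} (S : Set (Atom D)) (σ : Atom D) : Prop :=
  ∀ (A : Type) [Finite A] (X : ProbTeam D A), (∀ τ ∈ S, X.Sat τ) → X.Sat σ

/-- The set of all inclusions `x ⊆ y` such that `x ≈ y` or `y ≈ x` belongs to `S`. -/
def inclusionsOf {D : Type u} (S : Set (Atom D)) : Set (Atom D) :=
  {τ | ∃ x y : D, τ = Atom.uind x y ∧ (Atom.umi x y ∈ S ∨ Atom.umi y x ∈ S)}

end ProbTeamSem

/-!
The second equivalence only needs teams with one row: such a team satisfies every FD, so letting
each variable take its equivalence class under the closure of the given identities as its value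
shows that `x ≈ y`, or `x ⊆ y`, is implied only if `x` and `y` are in the same class.

In the first equivalence, a team that satisfies `x ≈ y` satisfies `x ⊆ y` and `y ⊆ x`
(`ProbTeam.Sat.uind_of_umi`), which settles one direction. For the other one, let `S` be the set
of the FDs and inclusions, and suppose that `S` does not imply `xs → ys`. Call a set of variables
closed if it is closed under the FDs implied by `S`; the closure of `xs` is closed and misses some
variable of `ys`. From a family `C₁, …, Cₙ` of closed sets one obtains a probabilistic team by
tossing `n` independent fair coins and letting the variable `x` show the outcomes of those coins
`i` with `x ∉ Cᵢ` (`bitAssignment`). All FDs in `S` hold in it, and `xs → ys` fails as soon as the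
closure of `xs` is one of the `Cᵢ`. Moreover, each variable is uniformly distributed, so `x ≈ y`
holds, for a suitable naming of the values, whenever `x` and `y` show the same number of coins.

It remains to choose the family so that variables identified by `S` show the same number of coins
(`exists_balanced_multiplicity`). This is where finiteness matters: rank the variables by the
number of values that they take in the models of `S`. Identified variables have the same rank. If
`x → y` is implied then `y` has at most the rank of `x`, and if the ranks agree then `y → x` is
implied as well, because a surjection between finite sets of the same size is injective
(`implies_fd_symm_of_valueLE`). So the closures of the single variables of a given rank partition
the variables of that rank and contain besides only variables of smaller rank. Proceeding from
the highest rank downwards, one can therefore equalize the number of coins within each rank by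
adding copies of these closures, without disturbing the ranks already treated.
-/

namespace ProbTeamSem

open Finset

/-! ### Probabilistic teams -/

section Teams

variable {D : Type u} {A : Type v}

theorem ProbTeam.marginal_pos {X : ProbTeam D A} {x : D} {a : A} :
    0 < X.marginal x a ↔ ∃ s ∈ X.rows, s x = a := by
  classical
  unfold ProbTeam.marginal
  rw [Finset.sum_pos_iff_of_nonneg fun s _ => (X.weight_mem s).1.le]
  constructor
  · rintro ⟨s, hs, -⟩
    exact ⟨s.1, s.2, by simpa using hs⟩
  · rintro ⟨s, hs, rfl⟩
    exact ⟨⟨s, hs⟩, by simp, (X.weight_mem _).1⟩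

/-- A marginal identity determines the set of values of positive probability, so it gives the
inclusion of the value sets. -/
theorem ProbTeam.Sat.uind_of_umi {X : ProbTeam D A} {x y : D} (h : X.Sat (Atom.umi x y)) :
    X.Sat (Atom.uind x y) := by
  intro s hs
  have hpos : 0 < X.marginal y (s x) := by
    rw [← h (s x)]
    exact ProbTeam.marginal_pos.2 ⟨s, hs, rfl⟩
  obtain ⟨s', hs', h'⟩ := ProbTeam.marginal_pos.1 hpos
  exact ⟨s', hs', h'.symm⟩

theorem ProbTeam.Sat.umi_symm {X : ProbTeam D A} {x y : D} (h : X.Sat (Atom.umi x y)) :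
    X.Sat (Atom.umi y x) := fun a => (h a).symm

theorem ProbTeam.sat_fd_iff {X : ProbTeam D A} {xs ys : List D} :
    X.Sat (Atom.fd xs ys) ↔ ∀ s ∈ X.rows, ∀ s' ∈ X.rows,
      (∀ x ∈ xs, s x = s' x) → ∀ y ∈ ys, s y = s' y := by
  simp only [ProbTeam.Sat, List.map_inj_left]

open Classical in
/-- The team of the random assignment `g ω`, where `ω` is uniformly distributed on `Ω`. -/
noncomputable def ProbTeam.ofUniform {Ω : Type*} [Fintype Ω] [Nonempty Ω] (g : Ω → D → A) :
    ProbTeam D A where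
  rows := univ.image g
  weight s := (#{ω | g ω = s.1} : ℝ) / Fintype.card Ω
  weight_mem s := by
    have hΩ : (0 : ℝ) < Fintype.card Ω := by exact_mod_cast Fintype.card_pos
    obtain ⟨ω, -, hω⟩ := Finset.mem_image.1 s.2
    constructor
    · refine div_pos ?_ hΩ
      exact_mod_cast Finset.card_pos.2 ⟨ω, by simpa using hω⟩
    · rw [div_le_one hΩ]
      exact_mod_cast Finset.card_le_univ _
  weight_sum := by
    have hΩ : (Fintype.card Ω : ℝ) ≠ 0 := by exact_mod_cast Fintype.card_ne_zero
    rw [← Finset.sum_div, div_eq_one_iff_eq hΩ,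
      Finset.sum_coe_sort (univ.image g) (fun s => (#{ω | g ω = s} : ℝ))]
    exact_mod_cast (Finset.card_eq_sum_card_image g univ).symm

theorem ProbTeam.mem_rows_ofUniform {Ω : Type*} [Fintype Ω] [Nonempty Ω] {g : Ω → D → A}
    {s : D → A} : s ∈ (ProbTeam.ofUniform g).rows ↔ ∃ ω, g ω = s := by
  simp [ProbTeam.ofUniform]

open Classical in
theorem ProbTeam.marginal_ofUniform {Ω : Type*} [Fintype Ω] [Nonempty Ω] (g : Ω → D → A)
    (x : D) (a : A) :
    (ProbTeam.ofUniform g).marginal x a = (#{ω | g ω x = a} : ℝ) / Fintype.card Ω := by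
  have h1 : (ProbTeam.ofUniform g).marginal x a =
      ∑ s ∈ univ.image g, if s x = a then (#{ω | g ω = s} : ℝ) / Fintype.card Ω else 0 := by
    unfold ProbTeam.marginal
    rw [Finset.sum_filter]
    exact Finset.sum_coe_sort (univ.image g)
      (fun s => if s x = a then (#{ω | g ω = s} : ℝ) / Fintype.card Ω else 0)
  rw [h1, ← Finset.sum_filter, ← Finset.sum_div]
  congr 1
  have h2 := Finset.card_eq_sum_card_fiberwise (f := g) (s := univ.filter fun ω => g ω x = a)
    (t := (univ.image g).filter fun s => s x = a) (by intro ω hω; simpa using hω)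
  rw [h2, Nat.cast_sum]
  refine Finset.sum_congr rfl fun s hs => ?_
  congr 2
  ext ω
  simp only [Finset.mem_filter, Finset.mem_univ, true_and] at hs ⊢
  constructor
  · rintro rfl
    exact ⟨hs.2, rfl⟩
  · exact fun h => h.2

/-- A permutation of the sample space that turns the random value of `x` into that of `y` yields
the marginal identity. -/
theorem ProbTeam.ofUniform_sat_umi {Ω : Type*} [Fintype Ω] [Nonempty Ω] {g : Ω → D → A} {x y : D}
    (e : Equiv.Perm Ω) (h : ∀ ω, g (e ω) y = g ω x) :
    (ProbTeam.ofUniform g).Sat (Atom.umi x y) := by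
  classical
  intro a
  rw [ProbTeam.marginal_ofUniform, ProbTeam.marginal_ofUniform]
  congr 2
  exact Finset.card_equiv e fun ω => by simp [h]

end Teams

/-! ### Marginal identities and one-row teams -/

section OneRow

variable {D : Type u}

/-- Two variables are identified by `S` if they are in the same class of the equivalence relation
generated by the marginal identities in `S`. -/
def Identified (S : Set (Atom D)) : D → D → Prop :=
  Relation.EqvGen fun x y => Atom.umi x y ∈ S

theorem Identified.sat_umi {S : Set (Atom D)} {A : Type v} {X : ProbTeam D A}
    (hX : ∀ τ ∈ S, X.Sat τ) {x y : D} (h : Identified S x y) : X.Sat (Atom.umi x y) := by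
  induction h with
  | rel x y h => exact hX _ h
  | refl x => exact fun a => rfl
  | symm x y _ ih => exact ih.umi_symm
  | trans x y z _ _ ih₁ ih₂ => exact fun a => (ih₁ a).trans (ih₂ a)

theorem Identified.sat_uind {S : Set (Atom D)} {A : Type v} {X : ProbTeam D A}
    (hX : ∀ τ ∈ inclusionsOf S, X.Sat τ) {x y : D} (h : Identified S x y) :
    X.Sat (Atom.uind x y) ∧ X.Sat (Atom.uind y x) := by
  induction h with
  | rel x y h => exact ⟨hX _ ⟨x, y, rfl, .inl h⟩, hX _ ⟨y, x, rfl, .inr h⟩⟩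
  | refl x => exact ⟨fun s hs => ⟨s, hs, rfl⟩, fun s hs => ⟨s, hs, rfl⟩⟩
  | symm x y _ ih => exact ih.symm
  | trans x y z _ _ ih₁ ih₂ =>
    have key : ∀ {u v w : D}, X.Sat (Atom.uind u v) → X.Sat (Atom.uind v w) →
        X.Sat (Atom.uind u w) := by
      intro u v w h₁ h₂ s hs
      obtain ⟨s', hs', e₁⟩ := h₁ s hs
      obtain ⟨s'', hs'', e₂⟩ := h₂ s' hs'
      exact ⟨s'', hs'', e₁.trans e₂⟩
    exact ⟨key ih₁.1 ih₂.1, key ih₂.2 ih₁.2⟩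

/-- There is a one-row team with values in a finite type in which identified variables, and only
these, have the same value. It satisfies all FDs. -/
theorem exists_oneRow_team [Finite D] (S : Set (Atom D)) :
    ∃ (n : ℕ) (X : ProbTeam D (Fin n)) (c : D → Fin n),
      (∀ s, s ∈ X.rows ↔ s = c) ∧ ∀ x y, c x = c y ↔ Identified S x y := by
  let r : Setoid D := Relation.EqvGen.setoid fun x y => Atom.umi x y ∈ S
  obtain ⟨n, ⟨e⟩⟩ := Finite.exists_equiv_fin (Quotient r)
  refine ⟨n, ProbTeam.ofUniform (Ω := Unit) fun _ x => e (Quotient.mk r x),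
    fun x => e (Quotient.mk r x), fun s => ?_, fun x y => ?_⟩
  · rw [ProbTeam.mem_rows_ofUniform]
    simp [eq_comm]
  · rw [e.apply_eq_iff_eq, Quotient.eq]
    exact Iff.rfl

theorem sat_fd_of_rows_eq {A : Type v} {X : ProbTeam D A} {c : D → A}
    (hX : ∀ s, s ∈ X.rows ↔ s = c) (xs ys : List D) : X.Sat (Atom.fd xs ys) := by
  intro s hs s' hs' _
  rw [(hX s).1 hs, (hX s').1 hs']

theorem sat_umi_of_rows_eq {A : Type v} {X : ProbTeam D A} {c : D → A}
    (hX : ∀ s, s ∈ X.rows ↔ s = c) {x y : D} (h : c x = c y) : X.Sat (Atom.umi x y) := by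
  intro a
  unfold ProbTeam.marginal
  congr 1
  ext s
  simp [(hX s.1).1 s.2, h]

theorem identified_of_implies_umi [Finite D] {SFD SUMI : Set (Atom D)}
    (hFD : ∀ τ ∈ SFD, τ.IsFD) (hUMI : ∀ τ ∈ SUMI, τ.IsUMI) {x y : D}
    (h : Implies (SFD ∪ SUMI) (Atom.umi x y)) : Identified SUMI x y := by
  obtain ⟨n, X, c, hX, hc⟩ := exists_oneRow_team SUMI
  have hsat := (h _ X ?_).uind_of_umi
  · obtain ⟨s, hs, e⟩ := hsat c ((hX c).2 rfl)
    rw [(hX s).1 hs] at e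
    exact (hc x y).1 e
  · rintro τ (hτ | hτ)
    · obtain ⟨xs, ys, rfl⟩ := hFD τ hτ
      exact sat_fd_of_rows_eq hX xs ys
    · obtain ⟨u, v, rfl⟩ := hUMI τ hτ
      exact sat_umi_of_rows_eq hX ((hc u v).2 (.rel _ _ hτ))

theorem identified_of_implies_uind [Finite D] {SFD SUMI : Set (Atom D)}
    (hFD : ∀ τ ∈ SFD, τ.IsFD) {x y : D}
    (h : Implies (SFD ∪ inclusionsOf SUMI) (Atom.uind x y)) : Identified SUMI x y := by
  obtain ⟨n, X, c, hX, hc⟩ := exists_oneRow_team SUMI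
  have hsat := h _ X ?_
  · obtain ⟨s, hs, e⟩ := hsat c ((hX c).2 rfl)
    rw [(hX s).1 hs] at e
    exact (hc x y).1 e
  · rintro τ (hτ | ⟨u, v, rfl, huv⟩)
    · obtain ⟨xs, ys, rfl⟩ := hFD τ hτ
      exact sat_fd_of_rows_eq hX xs ys
    · refine (sat_umi_of_rows_eq hX ((hc u v).2 ?_)).uind_of_umi
      exact huv.elim (fun h => .rel _ _ h) fun h => .symm _ _ (.rel _ _ h)

end OneRow

/-! ### Closed sets of variables and the comparison of value sets -/

section Closure

variable {D : Type u}

/-- The set of the variables that are functionally determined by the variables in `xs` in every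
model of `S`. -/
def fdClosure (S : Set (Atom D)) (xs : List D) : Set D :=
  {y | Implies S (Atom.fd xs [y])}

/-- A set of variables is closed if it contains all variables that are functionally determined by
some of its members in every model of `S`. -/
def IsFDClosed (S : Set (Atom D)) (C : Set D) : Prop :=
  ∀ xs : List D, (∀ x ∈ xs, x ∈ C) → fdClosure S xs ⊆ C

theorem mem_fdClosure_of_mem {S : Set (Atom D)} {xs : List D} {x : D} (hx : x ∈ xs) :
    x ∈ fdClosure S xs := by
  intro A _ X _
  rw [ProbTeam.sat_fd_iff]
  intro s _ s' _ h y hy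
  rw [List.mem_singleton.1 hy]
  exact h x hx

theorem implies_fd_iff {S : Set (Atom D)} {xs ys : List D} :
    Implies S (Atom.fd xs ys) ↔ ∀ y ∈ ys, y ∈ fdClosure S xs := by
  constructor
  · intro h y hy A _ X hX
    have h' := h A X hX
    rw [ProbTeam.sat_fd_iff] at h' ⊢
    intro s hs s' hs' e z hz
    rw [List.mem_singleton.1 hz]
    exact h' s hs s' hs' e y hy
  · intro h A _ X hX
    rw [ProbTeam.sat_fd_iff]
    intro s hs s' hs' e y hy
    exact ProbTeam.sat_fd_iff.1 (h y hy A X hX) s hs s' hs' e y (List.mem_singleton_self y)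

theorem isFDClosed_fdClosure (S : Set (Atom D)) (xs : List D) :
    IsFDClosed S (fdClosure S xs) := by
  intro zs hzs y hy A _ X hX
  have h₁ := implies_fd_iff.2 hzs A X hX
  have h₂ := hy A X hX
  rw [ProbTeam.sat_fd_iff] at h₁ h₂ ⊢
  exact fun s hs s' hs' e => h₂ s hs s' hs' (h₁ s hs s' hs' e)

open Classical in
/-- The set of values of the variable `x` in the team `X`. -/
noncomputable def ProbTeam.values {A : Type v} (X : ProbTeam D A) (x : D) : Finset A :=
  X.rows.image fun s => s x

/-- The preorder in which `x` is below `y` if, in every model of `S`, `x` takes at most as many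
values as `y`. -/
def ValueLE (S : Set (Atom D)) (x y : D) : Prop :=
  ∀ (A : Type) [Finite A] (X : ProbTeam D A), (∀ τ ∈ S, X.Sat τ) → #(X.values x) ≤ #(X.values y)

theorem ValueLE.trans {S : Set (Atom D)} {x y z : D} (h₁ : ValueLE S x y) (h₂ : ValueLE S y z) :
    ValueLE S x z := fun A _ X hX => (h₁ A X hX).trans (h₂ A X hX)

theorem ProbTeam.values_subset_of_uind {A : Type v} {X : ProbTeam D A} {x y : D}
    (h : X.Sat (Atom.uind x y)) : X.values x ⊆ X.values y := by
  classical
  intro a ha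
  obtain ⟨s, hs, rfl⟩ := Finset.mem_image.1 ha
  obtain ⟨s', hs', e⟩ := h s hs
  exact Finset.mem_image.2 ⟨s', hs', e.symm⟩

theorem ProbTeam.exists_values_map {A : Type v} {X : ProbTeam D A} {x y : D}
    (h : X.Sat (Atom.fd [x] [y])) :
    ∃ φ : A → A, (∀ s ∈ X.rows, φ (s x) = s y) ∧ Set.SurjOn φ (X.values x) (X.values y) := by
  classical
  rw [ProbTeam.sat_fd_iff] at h
  simp only [List.mem_singleton, forall_eq] at h
  have hφ : ∀ a : A, ∃ b : A, ∀ s ∈ X.rows, s x = a → s y = b := by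
    intro a
    by_cases ha : ∃ s ∈ X.rows, s x = a
    · obtain ⟨s, hs, rfl⟩ := ha
      exact ⟨s y, fun s' hs' e => h s' hs' s hs e⟩
    · push Not at ha
      exact ⟨a, fun s hs e => absurd e (ha s hs)⟩
  choose φ hφ using hφ
  refine ⟨φ, fun s hs => (hφ _ s hs rfl).symm, fun b hb => ?_⟩
  obtain ⟨s, hs, rfl⟩ := Finset.mem_image.1 hb
  exact ⟨s x, Finset.mem_image_of_mem _ hs, (hφ _ s hs rfl).symm⟩

theorem valueLE_of_mem_fdClosure {S : Set (Atom D)} {x y : D} (h : y ∈ fdClosure S [x]) :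
    ValueLE S y x := by
  intro A _ X hX
  obtain ⟨φ, -, hφ⟩ := ProbTeam.exists_values_map (h A X hX)
  exact Finset.card_le_card_of_surjOn φ hφ

/-- If `x → y` is implied and `y` takes at least as many values as `x` in every model, then `y → x`
is implied, because the surjection from the values of `x` to those of `y` is injective. -/
theorem implies_fd_symm_of_valueLE {S : Set (Atom D)} {x y : D} (h : y ∈ fdClosure S [x])
    (hle : ValueLE S x y) : x ∈ fdClosure S [y] := by
  classical
  intro A _ X hX
  obtain ⟨φ, hφ, hsurj⟩ := ProbTeam.exists_values_map (h A X hX)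
  have hmem : ∀ s ∈ X.rows, s x ∈ X.values x := fun s hs => Finset.mem_image_of_mem _ hs
  have himg : X.values y = (X.values x).image φ := by
    unfold ProbTeam.values
    rw [Finset.image_image]
    exact Finset.image_congr fun s hs => (hφ s hs).symm
  have hinj : Set.InjOn φ (X.values x) := by
    refine Finset.card_image_iff.1 (le_antisymm Finset.card_image_le ?_)
    rw [← himg]
    exact hle A X hX
  rw [ProbTeam.sat_fd_iff]
  simp only [List.mem_singleton, forall_eq]
  intro s hs s' hs' e
  exact hinj (hmem s hs) (hmem s' hs') (by rw [hφ s hs, hφ s' hs', e])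

open Classical in
/-- The number of variables that are below `x` for `ValueLE`. It is strictly monotone, so it turns
that preorder into a linear one. -/
noncomputable def valueRank [Fintype D] (S : Set (Atom D)) (x : D) : ℕ :=
  #{y | ValueLE S y x}

theorem valueRank_mono [Fintype D] {S : Set (Atom D)} {x y : D} (h : ValueLE S x y) :
    valueRank S x ≤ valueRank S y := by
  classical
  exact Finset.card_le_card fun z hz => by
    simp only [Finset.mem_filter, Finset.mem_univ, true_and] at hz ⊢
    exact hz.trans h

theorem valueLE_of_valueRank_eq [Fintype D] {S : Set (Atom D)} {x y : D} (h : ValueLE S x y)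
    (hr : valueRank S x = valueRank S y) : ValueLE S y x := by
  classical
  have hsub : (univ.filter fun z => ValueLE S z x) ⊆ univ.filter fun z => ValueLE S z y := by
    intro z hz
    simp only [Finset.mem_filter, Finset.mem_univ, true_and] at hz ⊢
    exact hz.trans h
  have heq := Finset.eq_of_subset_of_card_le hsub hr.ge
  have hy : y ∈ univ.filter fun z => ValueLE S z y := by
    simp only [Finset.mem_filter, Finset.mem_univ, true_and]
    exact fun A _ X _ => le_rfl
  rw [← heq] at hy
  simpa using hy

end Closure

/-! ### Balanced multiplicities -/

section Balance

variable {D : Type u}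

open Classical in
/-- Given a family `𝒞` of sets that contains with each `x` a least member `cl x` around `x`, and
ranks such that the sets `cl x`, for `x` of rank `k`, partition the elements of rank `k` and
otherwise consist of elements of smaller rank, the members of `𝒞` can be repeated in such a way
that elements of the same rank are missed by the same number of sets, and a prescribed member `C₀`
occurs. -/
theorem exists_balanced_multiplicity [Fintype D] {𝒞 : Set (Set D)} {cl : D → Set D} {r : D → ℕ}
    (hcl : ∀ x, cl x ∈ 𝒞) (hmem : ∀ x, x ∈ cl x) (hmin : ∀ C ∈ 𝒞, ∀ x ∈ C, cl x ⊆ C)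
    (hr : ∀ x, ∀ y ∈ cl x, r y ≤ r x) (hsymm : ∀ x, ∀ y ∈ cl x, r y = r x → x ∈ cl y)
    {C₀ : Set D} (hC₀ : C₀ ∈ 𝒞) :
    ∃ m : Set D → ℕ, m C₀ ≠ 0 ∧ (∀ C, m C ≠ 0 → C ∈ 𝒞) ∧
      ∀ x y, r x = r y → ∑ C with x ∉ C, m C = ∑ C with y ∉ C, m C := by
  obtain ⟨N, hN⟩ : ∃ N, ∀ x, r x < N :=
    ⟨univ.sup r + 1, fun x => Nat.lt_succ_of_le (Finset.le_sup (mem_univ x))⟩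
  -- Ranks are treated from the top, so the induction is on the number of treated ranks.
  suffices H : ∀ k, ∃ m : Set D → ℕ, m C₀ ≠ 0 ∧ (∀ C, m C ≠ 0 → C ∈ 𝒞) ∧
      ∀ x y, N ≤ r x + k → r x = r y → ∑ C with x ∉ C, m C = ∑ C with y ∉ C, m C by
    obtain ⟨m, h₁, h₂, h₃⟩ := H N
    exact ⟨m, h₁, h₂, fun x y => h₃ x y (Nat.le_add_left _ _)⟩
  intro k
  induction k with
  | zero =>
    refine ⟨fun C => if C = C₀ then 1 else 0, by simp, fun C hC => ?_, fun x y hx => ?_⟩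
    · by_cases h : C = C₀
      · exact h ▸ hC₀
      · simp [h] at hC
    · exact absurd (hN x) (by omega)
  | succ k ih =>
    obtain ⟨m, h₁, h₂, h₃⟩ := ih
    -- The new multiplicity of `cl x` makes the number of sets around `x` equal to the old total.
    let g : Set D → ℕ := fun C =>
      if ∃ x, r x + (k + 1) = N ∧ cl x = C then ∑ C' with ¬ C ⊆ C', m C' else 0
    have hg_of_lt : ∀ y, N < r y + (k + 1) → ∑ C with y ∈ C, g C = 0 := by
      intro y hy
      refine Finset.sum_eq_zero fun C hC => if_neg ?_
      rintro ⟨x, hx, rfl⟩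
      have := hr x y (by simpa using hC)
      omega
    have hg_of_eq : ∀ y, r y + (k + 1) = N → ∑ C with y ∈ C, g C = ∑ C with y ∉ C, m C := by
      intro y hy
      rw [Finset.sum_eq_single (cl y)]
      · simp only [g]
        rw [if_pos ⟨y, hy, rfl⟩, Finset.sum_filter, Finset.sum_filter]
        refine Finset.sum_congr rfl fun C _ => ?_
        by_cases hC : m C = 0
        · simp [hC]
        · have : cl y ⊆ C ↔ y ∈ C := ⟨fun h => h (hmem y), hmin C (h₂ C hC) y⟩
          simp only [this]
      · intro C hC hne
        refine if_neg ?_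
        rintro ⟨x, hx, rfl⟩
        have hyx : y ∈ cl x := by simpa using hC
        have hxy : x ∈ cl y := hsymm x y hyx (by omega)
        exact hne ((hmin _ (hcl y) x hxy).antisymm (hmin _ (hcl x) y hyx))
      · intro h
        exact absurd (by simpa using hmem y) h
    have split : ∀ (f : Set D → ℕ) (x : D),
        ∑ C with x ∈ C, f C + ∑ C with x ∉ C, f C = ∑ C, f C := fun f x =>
      Finset.sum_filter_add_sum_filter_not _ _ _
    refine ⟨fun C => m C + g C, fun h => h₁ (Nat.add_eq_zero_iff.1 h).1, fun C hC => ?_,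
      fun x y hx hxy => ?_⟩
    · by_cases hm : m C = 0
      · by_cases hex : ∃ x, r x + (k + 1) = N ∧ cl x = C
        · obtain ⟨x, -, rfl⟩ := hex
          exact hcl x
        · simp [g, hm, hex] at hC
      · exact h₂ C hm
    · rw [Finset.sum_add_distrib, Finset.sum_add_distrib]
      have sx := split g x
      have sy := split g y
      rcases Nat.lt_or_ge N (r x + (k + 1)) with hlt | hge
      · have := h₃ x y (by omega) hxy
        rw [hg_of_lt x hlt] at sx
        rw [hg_of_lt y (by omega)] at sy
        omega
      · rw [hg_of_eq x (by omega)] at sx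
        rw [hg_of_eq y (by omega)] at sy
        omega

end Balance

/-! ### Teams of independent bits -/

section Bits

variable {D : Type u} {n : ℕ}

theorem exists_perm_lt_card_iff (T : Finset (Fin n)) :
    ∃ π : Equiv.Perm (Fin n), ∀ i : Fin n, (i : ℕ) < #T ↔ π i ∈ T := by
  have hcard : Fintype.card {i : Fin n // (i : ℕ) < #T} = Fintype.card {i // i ∈ T} := by
    have hle : #T ≤ n := by simpa using Finset.card_le_univ T
    rw [Fintype.card_coe, Fintype.card_subtype]
    simp [Fin.card_filter_val_lt, hle]
  let e := Fintype.equivOfCardEq hcard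
  refine ⟨e.extendSubtype, fun i => ⟨fun h => e.extendSubtype_mem i h, fun h => ?_⟩⟩
  by_contra hi
  exact e.extendSubtype_not_mem i hi h

/-- A permutation of the positions that moves the members of `T` to the front. -/
noncomputable def frontPerm (T : Finset (Fin n)) : Equiv.Perm (Fin n) :=
  (exists_perm_lt_card_iff T).choose

theorem lt_card_iff_frontPerm_mem (T : Finset (Fin n)) (i : Fin n) :
    (i : ℕ) < #T ↔ frontPerm T i ∈ T :=
  (exists_perm_lt_card_iff T).choose_spec i

/-- The assignment in which `x` shows those of the bits `f` whose position is in `T x`. These bits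
are moved to the front and the word is padded with `false`, so that the set of values of `x`
depends only on the size of `T x`. -/
noncomputable def bitAssignment (T : D → Finset (Fin n)) (f : Fin n → Bool) (x : D) :
    Fin n → Bool :=
  fun i => if (i : ℕ) < #(T x) then f (frontPerm (T x) i) else false

theorem bitAssignment_eq_iff {T : D → Finset (Fin n)} {f f' : Fin n → Bool} {x : D} :
    bitAssignment T f x = bitAssignment T f' x ↔ ∀ i ∈ T x, f i = f' i := by
  constructor
  · intro h i hi
    have hlt : (((frontPerm (T x)).symm i : Fin n) : ℕ) < #(T x) := by
      rw [lt_card_iff_frontPerm_mem]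
      simpa using hi
    simpa [bitAssignment, hlt] using congrFun h ((frontPerm (T x)).symm i)
  · intro h
    funext i
    by_cases hlt : (i : ℕ) < #(T x)
    · simpa [bitAssignment, hlt] using h _ ((lt_card_iff_frontPerm_mem _ _).1 hlt)
    · simp [bitAssignment, hlt]

theorem ofUniform_bitAssignment_sat_umi {T : D → Finset (Fin n)} {x y : D}
    (h : #(T x) = #(T y)) : (ProbTeam.ofUniform (bitAssignment T)).Sat (Atom.umi x y) := by
  -- Permute the coins so that those shown by `y` take the places of those shown by `x`.
  refine ProbTeam.ofUniform_sat_umi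
    (((frontPerm (T y)).symm.trans (frontPerm (T x))).symm.arrowCongr (Equiv.refl Bool))
    fun f => ?_
  funext i
  simp [bitAssignment, h, Equiv.arrowCongr]

theorem ofUniform_bitAssignment_sat_fd_iff {T : D → Finset (Fin n)} {xs ys : List D} :
    (ProbTeam.ofUniform (bitAssignment T)).Sat (Atom.fd xs ys) ↔
      ∀ i, (∀ x ∈ xs, i ∉ T x) → ∀ y ∈ ys, i ∉ T y := by
  rw [ProbTeam.sat_fd_iff]
  simp only [ProbTeam.mem_rows_ofUniform, forall_exists_index, forall_apply_eq_imp_iff,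
    bitAssignment_eq_iff]
  constructor
  · intro h i hi y hy hiy
    -- Compare two outcomes that differ in the coin `i` only.
    have := h (fun _ => false) (fun j => decide (j = i))
      (fun x hx j hj => by
        have hne : j ≠ i := by
          rintro rfl
          exact hi x hx hj
        simp [hne]) y hy i hiy
    simp at this
  · intro h f f' e y hy i hi
    by_contra hne
    exact h i (fun x hx hix => hne (e x hx i hix)) y hy hi

end Bits

/-! ### Transfer of counterexamples -/

section Transfer

variable {D : Type u}

/-- An FD that is not implied by FDs and inclusions fails in a team that satisfies the FDs and the
marginal identities. -/
theorem implies_fd_of_implies_fd [Finite D] {SFD SUMI : Set (Atom D)}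
    (hFD : ∀ τ ∈ SFD, τ.IsFD) (hUMI : ∀ τ ∈ SUMI, τ.IsUMI) {xs ys : List D}
    (h : Implies (SFD ∪ SUMI) (Atom.fd xs ys)) :
    Implies (SFD ∪ inclusionsOf SUMI) (Atom.fd xs ys) := by
  classical
  have := Fintype.ofFinite D
  set S := SFD ∪ inclusionsOf SUMI with hS
  have hsingle : ∀ C, IsFDClosed S C → ∀ x ∈ C, fdClosure S [x] ⊆ C := fun C hC x hx =>
    hC [x] (by simpa using hx)
  obtain ⟨m, hm₀, hmC, hbal⟩ := exists_balanced_multiplicity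
    (𝒞 := {C | IsFDClosed S C}) (cl := fun x => fdClosure S [x]) (r := valueRank S)
    (fun x => isFDClosed_fdClosure S [x]) (fun x => mem_fdClosure_of_mem (by simp)) hsingle
    (fun x y hy => valueRank_mono (valueLE_of_mem_fdClosure hy))
    (fun x y hy he => implies_fd_symm_of_valueLE hy
      (valueLE_of_valueRank_eq (valueLE_of_mem_fdClosure hy) he))
    (isFDClosed_fdClosure S xs)
  obtain ⟨n, ⟨e⟩⟩ := Finite.exists_equiv_fin (Σ C : Set D, Fin (m C))
  let K : Fin n → Set D := fun i => (e.symm i).1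
  have hK : ∀ i, IsFDClosed S (K i) := fun i =>
    hmC _ (by have := (e.symm i).2.pos; simp only [K]; omega)
  let T : D → Finset (Fin n) := fun x => {i | x ∉ K i}
  have hT : ∀ x i, i ∈ T x ↔ x ∉ K i := fun x i => by simp [T]
  have hcard : ∀ x, #(T x) = ∑ C with x ∉ C, m C := by
    intro x
    have h₁ : #(T x) = #((univ.filter fun C : Set D => x ∉ C).sigma
        fun C => (univ : Finset (Fin (m C)))) :=
      Finset.card_equiv e.symm fun i => by simp [hT, K]
    rw [h₁, Finset.card_sigma]
    simp
  have hsat := h (Fin n → Bool) (ProbTeam.ofUniform (bitAssignment T)) ?_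
  · rw [implies_fd_iff]
    intro y hy
    by_contra hy'
    rw [ofUniform_bitAssignment_sat_fd_iff] at hsat
    -- A coin that belongs to a copy of the closure of `xs`.
    let i₀ : Fin n := e ⟨fdClosure S xs, ⟨0, Nat.pos_of_ne_zero hm₀⟩⟩
    have hK₀ : K i₀ = fdClosure S xs := by simp [K, i₀]
    refine hsat i₀ (fun x hx => ?_) y hy ((hT y i₀).2 ?_)
    · rw [hT, not_not, hK₀]
      exact mem_fdClosure_of_mem hx
    · rwa [hK₀]
  · rintro τ (hτ | hτ)
    · obtain ⟨us, vs, rfl⟩ := hFD τ hτ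
      rw [ofUniform_bitAssignment_sat_fd_iff]
      intro i hi v hv
      simp only [hT, not_not] at hi ⊢
      have himp : Implies S (Atom.fd us vs) := fun A _ X hX => hX _ (.inl hτ)
      exact hK i us hi (implies_fd_iff.1 himp v hv)
    · obtain ⟨u, v, rfl⟩ := hUMI τ hτ
      refine ofUniform_bitAssignment_sat_umi ?_
      rw [hcard, hcard]
      have hle : ∀ {a b : D}, Atom.uind a b ∈ inclusionsOf SUMI → ValueLE S a b :=
        fun hab A _ X hX =>
          Finset.card_le_card (ProbTeam.values_subset_of_uind (hX _ (.inr hab)))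
      exact hbal u v (le_antisymm (valueRank_mono (hle ⟨u, v, rfl, .inl hτ⟩))
        (valueRank_mono (hle ⟨v, u, rfl, .inr hτ⟩)))

/-- A team that satisfies the marginal identities satisfies the corresponding inclusions. -/
theorem Implies.of_inclusionsOf {SFD SUMI : Set (Atom D)} {σ : Atom D}
    (h : Implies (SFD ∪ inclusionsOf SUMI) σ) : Implies (SFD ∪ SUMI) σ := by
  intro A _ X hX
  refine h A X ?_
  rintro τ (hτ | ⟨u, v, rfl, huv | hvu⟩)
  · exact hX _ (.inl hτ)
  · exact (hX _ (.inr huv)).uind_of_umi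
  · exact (hX _ (.inr hvu)).umi_symm.uind_of_umi

end Transfer

end ProbTeamSem

theorem mainTheorem3 {D : Type u} [Finite D]
    (SFD SUMI : Set (ProbTeamSem.Atom D))
    (hFD : ∀ τ ∈ SFD, τ.IsFD) (hUMI : ∀ τ ∈ SUMI, τ.IsUMI) :
    (∀ σ : ProbTeamSem.Atom D, σ.IsFD →
      (ProbTeamSem.Implies (SFD ∪ SUMI) σ ↔
        ProbTeamSem.Implies (SFD ∪ ProbTeamSem.inclusionsOf SUMI) σ)) ∧
    (∀ x y : D,
      ProbTeamSem.Implies (SFD ∪ SUMI) (ProbTeamSem.Atom.umi x y) ↔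
        (ProbTeamSem.Implies (SFD ∪ ProbTeamSem.inclusionsOf SUMI) (ProbTeamSem.Atom.uind x y) ∧
          ProbTeamSem.Implies (SFD ∪ ProbTeamSem.inclusionsOf SUMI)
            (ProbTeamSem.Atom.uind y x))) := by
  refine ⟨?_, fun x y => ⟨fun h => ?_, fun h => ?_⟩⟩
  · rintro σ ⟨xs, ys, rfl⟩
    exact ⟨ProbTeamSem.implies_fd_of_implies_fd hFD hUMI,
      ProbTeamSem.Implies.of_inclusionsOf⟩
  · have hxy := ProbTeamSem.identified_of_implies_umi hFD hUMI h
    exact ⟨fun A _ X hX => (hxy.sat_uind fun τ hτ => hX τ (.inr hτ)).1,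
      fun A _ X hX => (hxy.sat_uind fun τ hτ => hX τ (.inr hτ)).2⟩
  · have hxy := ProbTeamSem.identified_of_implies_uind hFD h.1
    exact fun A _ X hX => hxy.sat_umi fun τ hτ => hX τ (.inr hτ)
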